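/- For a permutation $\sigma$ of $[n]=\{1,\dots,n\}$ let $\mathrm{wex}(\sigma)=\#\{i : i\le\sigma(i)\}$ be its number of weak excedances and $$\mathrm{cr}(\sigma)=\sum_{i=1}^n\#\{j : j<i\le\sigma(j)<\sigma(i)\}+\sum_{i=1}^n\#\{j : j>i>\sigma(j)>\sigma(i)\}$$ its number of crossings. Put $\mu_n^{(\ell)}(y,q)=\sum_{\sigma\in S_n}y^{\mathrm{wex}(\sigma)}q^{\mathrm{cr}(\sigma)}$ and $[m]_q=1+q+\cdots+q^{m-1}$, and let $\binom{n}{-1}=0$. Let $R$ be a commutative ring and $q\in R$ an invertible element (for instance, an indeterminate over $\mathbb Z$ in $R=\mathbb Z[q,q^{-1}]$). Then: (1) for every $n\ge 1$ and every $y$ in $R$ (hence also, applying this over $R[y]$, for an indeterminate $y$), $$\mu_n^{(\ell)}(y,q)=\sum_{k=1}^n y^k\sum_{i=0}^{k-1}(-1)^i\,[k-i]_q^n\,q^{k(i-k)}\left(\binom{n}{i}q^{k-i}+\binom{n}{i-1}\right);$$ (2) in the ring $R[[y]][[t]]$ of formal power series in the indeterminates $y$ and $t$, $$\sum_{n\ge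 0}\mu_n^{(\ell)}(y,q)\,t^n=\sum_{i\ge 0}\frac{y^i\,(q^{2i}-y)}{q^{i^2}\left(q^i-q^i[i]_q\,t+[i]_q\,t\,y\right)},$$ where the denominators are invertible and the sum on the right converges coefficientwise. -/

import Mathlib

open Finset

namespace QLaguerre

/-- The number of weak excedances of a permutation. The ground set `{1, …, n}` is modelled by
`Fin n`; only the order of the elements matters. -/
def wex {n : ℕ} (σ : Equiv.Perm (Fin n)) : ℕ :=
  #{i : Fin n | i ≤ σ i}

/-- The number of crossings of a permutation. -/
def cr {n : ℕ} (σ : Equiv.Perm (Fin n)) : ℕ :=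
  (∑ i : Fin n, #{j : Fin n | j < i ∧ i ≤ σ j ∧ σ j < σ i}) +
    ∑ i : Fin n, #{j : Fin n | j > i ∧ i > σ j ∧ σ j > σ i}

/-- The enumerator of the permutations of `n` letters by weak excedances (marked by `y`) and
crossings (marked by `q`), evaluated at elements `y`, `q` of an arbitrary commutative ring
(indeterminates included). -/
def mu {R : Type*} [CommRing R] (n : ℕ) (y q : R) : R :=
  ∑ σ : Equiv.Perm (Fin n), y ^ wex σ * q ^ cr σ

/-- The `q`-number `[m]_q = 1 + q + ⋯ + q ^ (m - 1)`. -/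
def qNum {R : Type*} [CommRing R] (q : R) (m : ℕ) : R :=
  ∑ j ∈ range m, q ^ j

/-- The binomial coefficient `n choose k` with an integer lower index: it is `0` if `k < 0`. -/
def chooseInt (n : ℕ) (k : ℤ) : ℕ :=
  if k < 0 then 0 else n.choose k.toNat

/-- The power series ring `R⟦y⟧⟦t⟧`. -/
abbrev SeriesYT (R : Type*) [CommRing R] : Type _ := PowerSeries (PowerSeries R)

namespace SeriesYT

variable {R : Type*} [CommRing R]

/-- The variable `y` in `R⟦y⟧⟦t⟧`. -/
noncomputable def y : SeriesYT R := PowerSeries.C PowerSeries.X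

/-- The variable `t` in `R⟦y⟧⟦t⟧`. -/
noncomputable def t : SeriesYT R := PowerSeries.X

/-- The constants of `R⟦y⟧⟦t⟧`. -/
noncomputable def const (a : R) : SeriesYT R := PowerSeries.C (PowerSeries.C a)

open scoped PowerSeries.WithPiTopology in
/-- `F = ∑ i, f i` in `R⟦y⟧⟦t⟧` as a convergent sum of formal power series: convergence is
coefficientwise, the coefficient ring `R` being discrete. -/
def HasFormalSum (f : ℕ → SeriesYT R) (F : SeriesYT R) : Prop :=
  letI : TopologicalSpace R := ⊥
  HasSum f F

end SeriesYT

open SeriesYT in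
/-- The generating series `∑ n, μ_n(y, q) t ^ n`, an element of `R⟦y⟧⟦t⟧`. -/
noncomputable def momentSeries {R : Type*} [CommRing R] (q : R) : SeriesYT R :=
  PowerSeries.mk fun n => mu n (PowerSeries.X : PowerSeries R) (PowerSeries.C q)

open SeriesYT in
/-- The denominator `q ^ (i ^ 2) * (q ^ i - q ^ i [i]_q t + [i]_q t y)`. -/
noncomputable def denom {R : Type*} [CommRing R] (q : R) (i : ℕ) : SeriesYT R :=
  const q ^ (i ^ 2) *
    (const q ^ i - const q ^ i * qNum (const q) i * t + qNum (const q) i * t * y)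

open SeriesYT in
/-- If `q` is invertible then the denominator is invertible in `R⟦y⟧⟦t⟧`. -/
theorem isUnit_denom {R : Type*} [CommRing R] (q : Rˣ) (i : ℕ) :
    IsUnit (denom (q : R) i) := by
  have hq : IsUnit (const (q : R)) := (q.isUnit.map PowerSeries.C).map PowerSeries.C
  refine (hq.pow _).mul (PowerSeries.isUnit_iff_constantCoeff.2 ?_)
  simpa [t, const] using (q.isUnit.map (PowerSeries.C (R := R))).pow i

open SeriesYT in
/-- The quotient
`y ^ i * (q ^ (2 i) - y) / (q ^ (i ^ 2) * (q ^ i - q ^ i [i]_q t + [i]_q t y))`,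
where `Ring.inverse` is the genuine inverse of the denominator whenever `q` is invertible. -/
noncomputable def momentSummand {R : Type*} [CommRing R] (q : R) (i : ℕ) : SeriesYT R :=
  y ^ i * (const q ^ (2 * i) - y) * Ring.inverse (denom q i)

end QLaguerre

/-! The proof shows that `mu n y q` is the `n`-th moment of a discrete measure, `mu n = ∑ i, mass i
* node i ^ n`, convergent `y`-adically. Both claims follow: the coefficient of `y ^ k` gives (1),
and summing the geometric series in `t` gives (2).

The combinatorial input concerns permutation matrices with a vanishing corner. Expanding along the
row or column bordering the corner gives the Motzkin recurrence with level weights `y [h+1] + [h]`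
and down weights `y [h+1] ^ 2` (`motzkin_succ_succ`). So `motzkin r h` may be read as `L (x ^ r
P_h)`, where `L` is the functional with moments `mu n` and `P_h` are its monic orthogonal
polynomials, of `q`-Laguerre type.

The second input is the Newton basis `N_k = ∏ j < k, (x - node j)`. Its coefficients in the `P_h`
are `connection k h`, so `newtonMoment r k` is `L (x ^ r N_k)`; `connection_three_term` makes this
compatible with multiplication by `x`. The measure has the same values on every `N_k`, by a
telescoping certificate (`mass_mul_newton_succ`), and induction on `r` passes from `N_k` to `x ^ r
N_k`. -/

namespace QLaguerre

/-! ### Insertion of a row and a column into a permutation matrix -/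

/-- The permutation obtained from `τ` by inserting a row `p` and a column `c` into its permutation
matrix, with `p ↦ c`. -/
def insertAt {n : ℕ} (p c : Fin (n + 1)) (τ : Equiv.Perm (Fin n)) : Equiv.Perm (Fin (n + 1)) :=
  ((finSuccEquiv' p).trans (Equiv.optionCongr τ)).trans (finSuccEquiv' c).symm

@[simp] lemma insertAt_self {n : ℕ} (p c : Fin (n + 1)) (τ : Equiv.Perm (Fin n)) :
    insertAt p c τ p = c := by
  simp [insertAt]

@[simp] lemma insertAt_succAbove {n : ℕ} (p c : Fin (n + 1)) (τ : Equiv.Perm (Fin n))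
    (i : Fin n) : insertAt p c τ (p.succAbove i) = c.succAbove (τ i) := by
  simp [insertAt]

lemma insertAt_injective {n : ℕ} (p c : Fin (n + 1)) :
    Function.Injective (insertAt p c) := by
  intro τ τ' h
  ext i : 1
  have := congrArg (fun σ : Equiv.Perm (Fin (n + 1)) => σ (p.succAbove i)) h
  simpa using this

lemma sum_perm_eq_sum_column {M : Type*} [AddCommMonoid M] {n : ℕ} (p : Fin (n + 1))
    (F : Equiv.Perm (Fin (n + 1)) → M) :
    ∑ σ, F σ = ∑ c, ∑ τ, F (insertAt p c τ) := by
  rw [← Fintype.sum_prod_type']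
  symm
  refine Function.Bijective.sum_comp (e := fun x : Fin (n + 1) × Equiv.Perm (Fin n) =>
    insertAt p x.1 x.2) ?_ F
  rw [Fintype.bijective_iff_injective_and_card]
  refine ⟨?_, by simp [Fintype.card_perm, Nat.factorial_succ]⟩
  rintro ⟨c, τ⟩ ⟨c', τ'⟩ h
  have hc : c = c' := by
    have := congrArg (fun σ : Equiv.Perm (Fin (n + 1)) => σ p) h
    simpa using this
  subst hc
  exact congrArg _ (insertAt_injective p c h)

lemma sum_perm_eq_sum_row {M : Type*} [AddCommMonoid M] {n : ℕ} (c : Fin (n + 1))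
    (F : Equiv.Perm (Fin (n + 1)) → M) :
    ∑ σ, F σ = ∑ p, ∑ τ, F (insertAt p c τ) := by
  rw [← Fintype.sum_prod_type']
  symm
  refine Function.Bijective.sum_comp (e := fun x : Fin (n + 1) × Equiv.Perm (Fin n) =>
    insertAt x.1 c x.2) ?_ F
  rw [Fintype.bijective_iff_injective_and_card]
  refine ⟨?_, by simp [Fintype.card_perm, Nat.factorial_succ]⟩
  rintro ⟨p, τ⟩ ⟨p', τ'⟩ h
  have hp : p = p' := by
    have := congrArg (fun σ : Equiv.Perm (Fin (n + 1)) => σ p) h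
    simp only [insertAt_self] at this
    exact (insertAt p' c τ').injective (this.symm.trans (insertAt_self p' c τ').symm)
  subst hp
  exact congrArg _ (insertAt_injective p c h)

/-! ### Vanishing corners and the effect of insertion on the statistics -/

/-- The first `a` rows of the permutation matrix of `σ` vanish in the first `b` columns. -/
def Avoids {n : ℕ} (a b : ℕ) (σ : Equiv.Perm (Fin n)) : Prop :=
  ∀ i : Fin n, (i : ℕ) < a → b ≤ (σ i : ℕ)

instance {n : ℕ} (a b : ℕ) : DecidablePred (Avoids (n := n) a b) :=
  fun σ => inferInstanceAs (Decidable (∀ i : Fin n, (i : ℕ) < a → b ≤ (σ i : ℕ)))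

lemma val_succAbove {n : ℕ} (p : Fin (n + 1)) (i : Fin n) :
    (p.succAbove i : ℕ) = if (i : ℕ) < p then (i : ℕ) else i + 1 := by
  simp only [Fin.succAbove, Fin.lt_def, Fin.val_castSucc]
  split_ifs <;> simp

lemma avoids_insertAt_row {n h : ℕ} {p c : Fin (n + 1)} (hp : (p : ℕ) = h + 1)
    (hc : (c : ℕ) ≤ h) (τ : Equiv.Perm (Fin n)) :
    Avoids (h + 1) (h + 1) (insertAt p c τ) ↔ Avoids (h + 1) h τ := by
  simp only [Avoids, Fin.forall_iff_succAbove p, insertAt_self, insertAt_succAbove, val_succAbove]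
  constructor
  · intro H i hi
    have := H.2 i
    split_ifs at this <;> omega
  · refine fun H => ⟨by omega, fun i => ?_⟩
    have := H i
    split_ifs <;> omega

lemma avoids_insertAt_column {n h : ℕ} {p c : Fin (n + 1)} (hc : (c : ℕ) = h)
    (hp : (p : ℕ) ≤ h) (τ : Equiv.Perm (Fin n)) :
    Avoids (h + 1) h (insertAt p c τ) ↔ Avoids h h τ := by
  simp only [Avoids, Fin.forall_iff_succAbove p, insertAt_self, insertAt_succAbove, val_succAbove]
  constructor
  · intro H i hi
    have := H.2 i
    split_ifs at this <;> omega
  · refine fun H => ⟨by omega, fun i => ?_⟩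
    have := H i
    split_ifs <;> omega

lemma wex_eq_sum {n : ℕ} (σ : Equiv.Perm (Fin n)) :
    wex σ = ∑ i : Fin n, if (i : ℕ) ≤ σ i then 1 else 0 := by
  rw [wex, card_filter]
  rfl

/-- The contribution to the number of crossings of a pair of arcs `i ↦ s` and `j ↦ t`. -/
def crossing (i s j t : ℕ) : ℕ :=
  (if j < i ∧ i ≤ t ∧ t < s then 1 else 0) + if i < j ∧ t < i ∧ s < t then 1 else 0

lemma cr_eq_sum {n : ℕ} (σ : Equiv.Perm (Fin n)) :
    cr σ = ∑ i : Fin n, ∑ j : Fin n, crossing i (σ i) j (σ j) := by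
  simp only [crossing, sum_add_distrib, cr, card_filter]
  rfl

lemma cr_insertAt {n : ℕ} (p c : Fin (n + 1)) (τ : Equiv.Perm (Fin n)) :
    cr (insertAt p c τ) =
      (∑ i : Fin n, ∑ j : Fin n, crossing (p.succAbove i) (c.succAbove (τ i))
        (p.succAbove j) (c.succAbove (τ j))) +
      ∑ i : Fin n, (crossing p c (p.succAbove i) (c.succAbove (τ i)) +
        crossing (p.succAbove i) (c.succAbove (τ i)) p c) := by
  rw [cr_eq_sum]
  simp only [Fin.sum_univ_succAbove _ p, insertAt_self, insertAt_succAbove, sum_add_distrib]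
  have : crossing p c p c = 0 := by simp [crossing]
  omega

lemma wex_insertAt_row {n h : ℕ} {p c : Fin (n + 1)} (hp : (p : ℕ) = h + 1)
    (hc : (c : ℕ) ≤ h) {τ : Equiv.Perm (Fin n)} (hτ : Avoids (h + 1) h τ) :
    wex (insertAt p c τ) = wex τ := by
  rw [wex_eq_sum, wex_eq_sum, Fin.sum_univ_succAbove _ p]
  simp only [insertAt_self, insertAt_succAbove, val_succAbove]
  rw [if_neg (by omega), zero_add]
  refine sum_congr rfl fun i _ => if_congr ?_ rfl rfl
  have := hτ i
  split_ifs <;> omega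

lemma wex_insertAt_column {n h : ℕ} {p c : Fin (n + 1)} (hc : (c : ℕ) = h)
    (hp : (p : ℕ) ≤ h) {τ : Equiv.Perm (Fin n)} (hτ : Avoids h h τ) :
    wex (insertAt p c τ) = wex τ + 1 := by
  rw [wex_eq_sum, wex_eq_sum, Fin.sum_univ_succAbove _ p]
  simp only [insertAt_self, insertAt_succAbove, val_succAbove]
  rw [if_pos (by omega), add_comm]
  congr 1
  refine sum_congr rfl fun i _ => if_congr ?_ rfl rfl
  have := hτ i
  split_ifs <;> omega

lemma sum_ite_val_mem_Ico {n a b : ℕ} (hb : b ≤ n) :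
    (∑ i : Fin n, if a ≤ (i : ℕ) ∧ (i : ℕ) < b then 1 else 0) = b - a := by
  rw [Fin.sum_univ_eq_sum_range (fun i => if a ≤ i ∧ i < b then 1 else 0) n, ← card_filter,
    ← Nat.card_Ico]
  congr 1
  ext i
  simp only [mem_filter, mem_range, mem_Ico]
  omega

/-- The new arc `p ↦ c` is a strict descent. The rows above `p` avoid the corner, so it crosses
exactly the arcs from rows below `p` that end in the columns strictly after `c` and up to `h`; in
`τ` these are the columns of `[c, h)`. -/
lemma cr_insertAt_row {n h : ℕ} {p c : Fin (n + 1)} (hp : (p : ℕ) = h + 1)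
    (hc : (c : ℕ) ≤ h) {τ : Equiv.Perm (Fin n)} (hτ : Avoids (h + 1) h τ) :
    cr (insertAt p c τ) = cr τ + (h - c) := by
  rw [cr_insertAt, cr_eq_sum]
  congr 1
  · refine sum_congr rfl fun i _ => sum_congr rfl fun j _ => ?_
    have hi := hτ i
    have hj := hτ j
    simp only [val_succAbove, crossing]
    congr 1 <;> refine if_congr ?_ rfl rfl <;> split_ifs <;> omega
  · rw [← sum_ite_val_mem_Ico (n := n) (a := c) (b := h) (by omega),
      ← Equiv.sum_comp τ (fun i : Fin n => if (c : ℕ) ≤ i ∧ (i : ℕ) < h then 1 else 0)]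
    refine sum_congr rfl fun i _ => ?_
    have hi := hτ i
    simp only [val_succAbove, crossing]
    split_ifs <;> omega

/-- Now the new arc is a weak excedance, and it crosses exactly the arcs from the rows strictly
after `p` and up to `h`, all of which end beyond column `h`; in `τ` these are the rows of `[p, h)`.
-/
lemma cr_insertAt_column {n h : ℕ} {p c : Fin (n + 1)} (hc : (c : ℕ) = h)
    (hp : (p : ℕ) ≤ h) {τ : Equiv.Perm (Fin n)} (hτ : Avoids h h τ) :
    cr (insertAt p c τ) = cr τ + (h - p) := by
  rw [cr_insertAt, cr_eq_sum]
  congr 1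
  · refine sum_congr rfl fun i _ => sum_congr rfl fun j _ => ?_
    have hi := hτ i
    have hj := hτ j
    simp only [val_succAbove, crossing]
    congr 1 <;> refine if_congr ?_ rfl rfl <;> split_ifs <;> omega
  · rw [← sum_ite_val_mem_Ico (n := n) (a := p) (b := h) (by omega)]
    refine sum_congr rfl fun i _ => ?_
    have hi := hτ i
    simp only [val_succAbove, crossing]
    split_ifs <;> omega

/-! ### Corner expansions and the Motzkin recurrence -/

variable {R : Type*} [CommRing R]

/-- The enumerator of the permutations whose matrix has a vanishing `a × b` corner. -/
def muAvoid (n a b : ℕ) (y q : R) : R :=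
  ∑ σ : Equiv.Perm (Fin n), if Avoids a b σ then y ^ wex σ * q ^ cr σ else 0

lemma muAvoid_zero_zero (n : ℕ) (y q : R) : muAvoid n 0 0 y q = mu n y q := by
  simp [muAvoid, mu, Avoids]

lemma muAvoid_zero_right (n a : ℕ) (y q : R) : muAvoid n a 0 y q = mu n y q := by
  simp [muAvoid, mu, Avoids]

lemma mu_zero (y q : R) : mu 0 y q = 1 := by
  simp [mu, wex, cr]

lemma muAvoid_self {h : ℕ} (hh : h ≠ 0) (y q : R) : muAvoid h h h y q = 0 := by
  refine sum_eq_zero fun σ _ => if_neg fun H => ?_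
  have := H ⟨0, by omega⟩ (by simp; omega)
  omega

lemma sum_fin_qpow_sub {n h : ℕ} (hh : h ≤ n) (q : R) :
    (∑ c : Fin (n + 1), if (c : ℕ) ≤ h then q ^ (h - (c : ℕ)) else 0) = qNum q (h + 1) := by
  rw [Fin.sum_univ_eq_sum_range (fun c => if c ≤ h then q ^ (h - c) else 0) (n + 1),
    ← sum_filter, qNum, ← sum_range_reflect]
  refine sum_congr ?_ fun c hc => ?_
  · ext c
    simp only [mem_filter, mem_range]
    omega
  · congr 1

lemma avoids_succ_iff_row {n h b : ℕ} (p : Fin n) (hp : (p : ℕ) = h) (σ : Equiv.Perm (Fin n)) :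
    Avoids (h + 1) b σ ↔ Avoids h b σ ∧ b ≤ σ p := by
  constructor
  · exact fun H => ⟨fun i hi => H i (by omega), H p (by omega)⟩
  · rintro ⟨H, hb⟩ i hi
    by_cases hip : i = p
    · exact hip ▸ hb
    · exact H i (by have : (i : ℕ) ≠ p := fun e => hip (Fin.ext e)
                    omega)

lemma avoids_succ_iff_column {n h a : ℕ} (c : Fin n) (hc : (c : ℕ) = h)
    (σ : Equiv.Perm (Fin n)) :
    Avoids a (h + 1) σ ↔ Avoids a h σ ∧ a ≤ σ.symm c := by
  constructor
  · refine fun H => ⟨fun i hi => (Nat.le_succ _).trans (H i hi), ?_⟩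
    by_contra! hlt
    have := H _ hlt
    simp at this
    omega
  · rintro ⟨H, ha⟩ i hi
    have h1 := H i hi
    have h2 : (σ i : ℕ) ≠ h := by
      intro e
      have : σ i = c := Fin.ext (by omega)
      rw [← this] at ha
      simp at ha
      omega
    omega

/-- Expansion along a row. -/
lemma muAvoid_row {n h : ℕ} (hh : h + 1 ≤ n) (y q : R) :
    muAvoid (n + 1) (h + 1) (h + 1) y q =
      muAvoid (n + 1) (h + 2) (h + 1) y q + qNum q (h + 1) * muAvoid n (h + 1) h y q := by
  let p : Fin (n + 1) := ⟨h + 1, by omega⟩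
  -- Either row `h + 1` also avoids the first `h + 1` columns, which enlarges the corner, or its
  -- entry lies in a column `c ≤ h` and can be deleted at the cost `q ^ (h - c)`; these weights sum
  -- to `[h+1]`.
  have key : ∀ σ : Equiv.Perm (Fin (n + 1)),
      (if Avoids (h + 1) (h + 1) σ then y ^ wex σ * q ^ cr σ else 0) =
        (if Avoids (h + 2) (h + 1) σ then y ^ wex σ * q ^ cr σ else 0) +
        if (σ p : ℕ) ≤ h then
          (if Avoids (h + 1) (h + 1) σ then y ^ wex σ * q ^ cr σ else 0) else 0 := by
    intro σ
    rw [if_congr (avoids_succ_iff_row (h := h + 1) p rfl σ) rfl rfl]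
    by_cases h1 : Avoids (h + 1) (h + 1) σ <;> by_cases h2 : (σ p : ℕ) ≤ h
    · simp [h1, h2, show ¬ h + 1 ≤ (σ p : ℕ) by omega]
    · simp [h1, h2, show h + 1 ≤ (σ p : ℕ) by omega]
    · simp [h1]
    · simp [h1]
  rw [muAvoid, sum_congr rfl fun σ _ => key σ, sum_add_distrib, ← muAvoid,
    sum_perm_eq_sum_column p, ← sum_fin_qpow_sub (show h ≤ n by omega), sum_mul]
  congr 1
  refine sum_congr rfl fun c _ => ?_
  simp only [insertAt_self]
  split_ifs with hc
  · rw [muAvoid, mul_sum]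
    refine sum_congr rfl fun τ _ => ?_
    rw [if_congr (avoids_insertAt_row (p := p) rfl hc τ) rfl rfl]
    split_ifs with hτ
    · rw [wex_insertAt_row rfl hc hτ, cr_insertAt_row rfl hc hτ, pow_add]
      ring
    · simp
  · simp

/-- Expansion along a column. -/
lemma muAvoid_column {n h : ℕ} (hh : h ≤ n) (y q : R) :
    muAvoid (n + 1) (h + 1) h y q =
      muAvoid (n + 1) (h + 1) (h + 1) y q + y * qNum q (h + 1) * muAvoid n h h y q := by
  let c : Fin (n + 1) := ⟨h, by omega⟩
  have key : ∀ σ : Equiv.Perm (Fin (n + 1)),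
      (if Avoids (h + 1) h σ then y ^ wex σ * q ^ cr σ else 0) =
        (if Avoids (h + 1) (h + 1) σ then y ^ wex σ * q ^ cr σ else 0) +
        if (σ.symm c : ℕ) ≤ h then
          (if Avoids (h + 1) h σ then y ^ wex σ * q ^ cr σ else 0) else 0 := by
    intro σ
    rw [if_congr (avoids_succ_iff_column (h := h) c rfl σ) rfl rfl]
    by_cases h1 : Avoids (h + 1) h σ <;> by_cases h2 : (σ.symm c : ℕ) ≤ h
    · simp [h1, h2, show ¬ h + 1 ≤ (σ.symm c : ℕ) by omega]
    · simp [h1, h2, show h + 1 ≤ (σ.symm c : ℕ) by omega]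
    · simp [h1]
    · simp [h1]
  rw [muAvoid, sum_congr rfl fun σ _ => key σ, sum_add_distrib, ← muAvoid,
    sum_perm_eq_sum_row c, ← sum_fin_qpow_sub hh, mul_sum, sum_mul]
  congr 1
  refine sum_congr rfl fun p _ => ?_
  have hs : ∀ τ, (insertAt p c τ).symm c = p := fun τ => by
    rw [Equiv.symm_apply_eq, insertAt_self]
  simp only [hs]
  split_ifs with hp
  · rw [muAvoid, mul_sum]
    refine sum_congr rfl fun τ _ => ?_
    rw [if_congr (avoids_insertAt_column (c := c) rfl hp τ) rfl rfl]
    split_ifs with hτ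
    · rw [wex_insertAt_column rfl hp hτ, cr_insertAt_column rfl hp hτ, pow_add, pow_succ]
      ring
    · simp
  · simp

/-- The enumerator of weighted Motzkin paths, realised by permutations: paths of length `r` descending from height `h` to
height `0`. -/
def motzkin (y q : R) (r h : ℕ) : R := muAvoid (h + r) h h y q

lemma motzkin_zero_right (y q : R) (r : ℕ) : motzkin y q r 0 = mu r y q := by
  rw [motzkin, muAvoid_zero_zero, zero_add]

lemma motzkin_zero_zero (y q : R) : motzkin y q 0 0 = 1 := by
  rw [motzkin_zero_right, mu_zero]

lemma motzkin_zero_succ (y q : R) (h : ℕ) : motzkin y q 0 (h + 1) = 0 :=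
  muAvoid_self (Nat.succ_ne_zero h) y q

lemma motzkin_succ_zero (y q : R) (r : ℕ) :
    motzkin y q (r + 1) 0 = motzkin y q r 1 + y * motzkin y q r 0 := by
  have h1 := muAvoid_column (n := r) (h := 0) (Nat.zero_le _) y q
  rw [muAvoid_zero_right, ← motzkin_zero_right] at h1
  rw [h1]
  simp [motzkin, add_comm, qNum]

/-- A Motzkin step is two half-steps: a row expansion followed by a column expansion of each of its
two terms. The two mixed products form the level weight. -/
lemma motzkin_succ_succ (y q : R) (r h : ℕ) :
    motzkin y q (r + 1) (h + 1) = motzkin y q r (h + 2) +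
      (y * qNum q (h + 2) + qNum q (h + 1)) * motzkin y q r (h + 1) +
        y * qNum q (h + 1) ^ 2 * motzkin y q r h := by
  have h1 := muAvoid_row (n := h + 1 + r) (h := h) (by omega) y q
  have h2 := muAvoid_column (n := h + 1 + r) (h := h + 1) (by omega) y q
  have h3 := muAvoid_column (n := h + r) (h := h) (by omega) y q
  simp only [motzkin]
  rw [show h + 1 + (r + 1) = h + 1 + r + 1 by ring, show h + 2 + r = h + 1 + r + 1 by ring, h1, h2,
    show h + 1 + r = h + r + 1 by ring, h3]
  ring

/-! ### The Newton basis and its moments -/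

lemma qNum_succ (q : R) (n : ℕ) : qNum q (n + 1) = qNum q n + q ^ n := sum_range_succ _ _

lemma qNum_succ' (q : R) (n : ℕ) : qNum q (n + 1) = 1 + q * qNum q n := by
  rw [qNum, sum_range_succ', qNum, mul_sum, pow_zero, add_comm]
  simp only [pow_succ']

@[simp] lemma qNum_zero (q : R) : qNum q 0 = 0 := rfl

/-- The coefficients expressing the Newton basis at the nodes `[i]_q (1 - y q ^ (-i))` in terms of
the `q`-Laguerre polynomials; `qi` stands for the inverse of `q`. -/
def connection (y q qi : R) : ℕ → ℕ → R
  | 0, 0 => 1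
  | 0, _ + 1 => 0
  | k + 1, 0 => y * (1 + qi ^ k * qNum q k) * connection y q qi k 0
  | k + 1, h + 1 => connection y q qi k h +
      y * (qNum q (h + 2) + qi ^ k * qNum q k) * connection y q qi k (h + 1)

lemma connection_eq_zero (y q qi : R) {k h : ℕ} (hkh : k < h) : connection y q qi k h = 0 := by
  induction k generalizing h with
  | zero => obtain ⟨h, rfl⟩ := Nat.exists_eq_succ_of_ne_zero hkh.ne'; rfl
  | succ k ih =>
    obtain ⟨h, rfl⟩ := Nat.exists_eq_succ_of_ne_zero (Nat.ne_zero_of_lt hkh)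
    rw [connection, ih (by omega), ih (by omega)]
    simp

/-- This is what remains on equating the coefficients of `P_h` in `x N_k = N_{k+1} + node k * N_k`,
once the defining recurrence of `connection` is inserted. -/
lemma connection_three_term {y q qi : R} (hq : q * qi = 1) (k h : ℕ) :
    (qNum q k - qNum q h) * connection y q qi k h =
      y * qNum q (h + 1) ^ 2 * connection y q qi k (h + 1) := by
  induction k generalizing h with
  | zero => cases h <;> simp [connection]
  | succ k ih =>
    have hk : qi ^ k * q ^ k = 1 := by rw [← mul_pow, mul_comm, hq, one_pow]
    have e1 := qNum_succ q k
    have e2 := qNum_succ' q k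
    cases h with
    | zero =>
      have h0 := ih 0
      clear ih
      simp only [connection, zero_add, qNum_succ' q 0, qNum_succ' q 1, qNum_zero] at *
      grind
    | succ h =>
      have h0 := ih h
      have h1 : (qNum q k - qNum q (h + 1)) * connection y q qi k (h + 1) =
        y * qNum q (h + 2) ^ 2 * connection y q qi k (h + 2) := ih (h + 1)
      -- The bracket equals `q ^ k`, by the two recurrences for `[k+1]`.
      have hw : qi ^ k * qNum q k * (1 + q * qNum q k - qNum q k) = qNum q k := by
        linear_combination qNum q k * hk + qi ^ k * qNum q k * (e1 - e2)
      have e3 := qNum_succ' q h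
      have e4 : qNum q (h + 2) = 1 + q * qNum q (h + 1) := qNum_succ' q (h + 1)
      have e5 : qNum q (h + 3) = 1 + q * qNum q (h + 2) := qNum_succ' q (h + 2)
      change (qNum q (k + 1) - qNum q (h + 1)) * (connection y q qi k h +
          y * (qNum q (h + 2) + qi ^ k * qNum q k) * connection y q qi k (h + 1)) =
        y * qNum q (h + 2) ^ 2 * (connection y q qi k (h + 1) +
          y * (qNum q (h + 3) + qi ^ k * qNum q k) * connection y q qi k (h + 2))
      rw [e5, e2]
      rw [e4, e3] at h1 ⊢
      rw [e3] at h0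
      linear_combination q * h0 + y * (1 + q * (1 + q * (1 + q * qNum q h)) + qi ^ k * qNum q k) *
        h1 + y * connection y q qi k (h + 1) * hw

/-- The nodes of the discrete measure whose moments are `mu n y q`. -/
def node (y q qi : R) (i : ℕ) : R := qNum q i * (1 - y * qi ^ i)

/-- The moments of the Newton basis. -/
def newtonMoment (y q qi : R) (r k : ℕ) : R :=
  ∑ h ∈ range (k + 1), connection y q qi k h * motzkin y q r h

lemma newtonMoment_zero_right (y q qi : R) (r : ℕ) : newtonMoment y q qi r 0 = mu r y q := by
  simp [newtonMoment, connection, motzkin_zero_right]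

lemma newtonMoment_zero_left (y q qi : R) (k : ℕ) :
    newtonMoment y q qi 0 k = connection y q qi k 0 := by
  simp [newtonMoment, sum_range_succ', motzkin_zero_succ, motzkin_zero_zero]

lemma connection_succ_zero {q qi : R} (hq : q * qi = 1) (y : R) (k : ℕ) :
    connection y q qi (k + 1) 0 = y * qNum q (k + 1) * qi ^ k * connection y q qi k 0 := by
  have hk : qi ^ k * q ^ k = 1 := by rw [← mul_pow, mul_comm, hq, one_pow]
  rw [connection, qNum_succ]
  linear_combination (-y * connection y q qi k 0) * hk

/-- This is `L` applied to `x ^ r * (x N_k) = x ^ r * (N_{k+1} + node k * N_k)`. -/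
lemma newtonMoment_succ_left {q qi : R} (hq : q * qi = 1) (y : R) (r k : ℕ) :
    newtonMoment y q qi (r + 1) k =
      newtonMoment y q qi r (k + 1) + node y q qi k * newtonMoment y q qi r k := by
  set u := motzkin y q r with hu
  set b := connection y q qi with hb
  have h1 : newtonMoment y q qi (r + 1) k =
      (∑ h ∈ range (k + 1), b k h * u (h + 1)) +
        (∑ h ∈ range (k + 1), b k h * (y * qNum q (h + 1) + qNum q h) * u h) +
        ∑ h ∈ range k, (y * qNum q (h + 1) ^ 2 * b k (h + 1)) * u h := by
    rw [newtonMoment, sum_range_succ' _ k, sum_range_succ' (fun h => b k h * u (h + 1)) k,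
      sum_range_succ' (fun h => b k h * (y * qNum q (h + 1) + qNum q h) * u h) k,
      motzkin_succ_zero, sum_congr rfl fun h _ => by rw [motzkin_succ_succ]]
    simp only [mul_add, add_mul, sum_add_distrib, ← hu, ← hb, qNum_zero, qNum_succ' q 0]
    have e : ∑ h ∈ range k, b k (h + 1) * (y * qNum q (h + 1) ^ 2 * u h) =
        ∑ h ∈ range k, y * qNum q (h + 1) ^ 2 * b k (h + 1) * u h :=
      sum_congr rfl fun h _ => by ring
    rw [e]
    simp only [mul_assoc]
    ring
  have h2 : ∑ h ∈ range k, (y * qNum q (h + 1) ^ 2 * b k (h + 1)) * u h =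
      ∑ h ∈ range (k + 1), (qNum q k - qNum q h) * b k h * u h := by
    rw [sum_range_succ _ k, sub_self, zero_mul, zero_mul, add_zero]
    exact sum_congr rfl fun h _ => by rw [hb, connection_three_term hq]
  have h3 : newtonMoment y q qi r (k + 1) =
      (∑ h ∈ range (k + 1), b k h * u (h + 1)) +
        ∑ h ∈ range (k + 1), y * (qNum q (h + 1) + qi ^ k * qNum q k) * b k h * u h := by
    -- The extra term `h = k + 1` vanishes because `connection` is triangular.
    have e : ∑ h ∈ range (k + 1), y * (qNum q (h + 1) + qi ^ k * qNum q k) * b k h * u h =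
        ∑ h ∈ range (k + 2), y * (qNum q (h + 1) + qi ^ k * qNum q k) * b k h * u h := by
      rw [sum_range_succ _ (k + 1), hb, connection_eq_zero y q qi (Nat.lt_succ_self k)]
      simp
    rw [e, newtonMoment, sum_range_succ' _ (k + 1), sum_range_succ' _ (k + 1), ← add_assoc,
      ← sum_add_distrib]
    congr 1
    · refine sum_congr rfl fun h _ => ?_
      rw [connection, ← hb, ← hu]
      ring
    · rw [connection, qNum_succ' q 0, qNum_zero, ← hb, ← hu]
      ring
  rw [h1, h2, h3, newtonMoment, ← hu, ← hb, mul_sum]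
  simp only [← sum_add_distrib]
  refine sum_congr rfl fun h _ => ?_
  rw [node]
  ring

/-! ### The discrete measure and its telescoping certificate -/

/-- The masses of the discrete measure whose moments are `mu n y q`. -/
def mass (y q qi : R) (i : ℕ) : R := y ^ i * (q ^ (2 * i) - y) * qi ^ (i ^ 2 + i)

/-- The values at the nodes of the Newton basis. -/
def newton (y q qi : R) (k i : ℕ) : R :=
  ∏ j ∈ range k, ((qNum q i - qNum q j) * (1 - y * qi ^ i * qi ^ j))

lemma newton_succ (y q qi : R) (k i : ℕ) :
    newton y q qi (k + 1) i =
      newton y q qi k i * ((qNum q i - qNum q k) * (1 - y * qi ^ i * qi ^ k)) :=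
  prod_range_succ _ _

lemma pow_mul_qNum_sub (q : R) (i j : ℕ) :
    qNum q i * (q ^ j - 1) = qNum q j * (q ^ i - 1) := by
  rw [← geom_sum_mul, ← geom_sum_mul]
  simp only [qNum]
  ring

lemma node_sub_mul_newton {q qi : R} (hq : q * qi = 1) (y : R) (k i : ℕ) :
    newton y q qi (k + 1) i = (node y q qi i - node y q qi k) * newton y q qi k i := by
  have hi : qi ^ i * q ^ i = 1 := by rw [← mul_pow, mul_comm, hq, one_pow]
  have hk : qi ^ k * q ^ k = 1 := by rw [← mul_pow, mul_comm, hq, one_pow]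
  have e := pow_mul_qNum_sub q i k
  have : (qNum q i - qNum q k) * (1 - y * qi ^ i * qi ^ k) = node y q qi i - node y q qi k := by
    rw [node, node]
    grind
  rw [newton_succ, this, mul_comm]

/-- The ratio of Newton values at consecutive nodes, cleared of denominators since nothing but `q`
is assumed invertible. It lets `certificate k (i + 1)` be written through `newton k i`. -/
lemma newton_succ_right (q qi y : R) (k i : ℕ) :
    newton y q qi k (i + 1) * (1 - y * qi ^ i) * (qNum q (i + 1) - qNum q k) =
      q ^ k * qNum q (i + 1) * newton y q qi k i * (1 - y * qi ^ i * qi ^ k) := by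
  induction k with
  | zero => simp [newton]; ring
  | succ k ih =>
    have e1 := qNum_succ' q i
    have e2 := qNum_succ' q k
    have e3 : qNum q (i + 1) - qNum q (k + 1) = q * (qNum q i - qNum q k) := by
      rw [e1, e2]; ring
    have e4 : qi ^ (i + 1) * qi ^ k = qi ^ i * qi ^ (k + 1) := by ring
    rw [newton_succ, newton_succ, mul_assoc y, e4, e3]
    linear_combination
      (1 - y * (qi ^ i * qi ^ (k + 1))) * (q * (qNum q i - qNum q k)) * ih

/-- The certificate for the recursion satisfied by the moments of the Newton basis. -/
def certificate (y q qi : R) (k i : ℕ) : R :=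
  -(y ^ i * qi ^ (i ^ 2 + i) * q ^ (2 * i) * (1 - y * q * qi ^ i) * newton y q qi k i *
    (qNum q i - qNum q k))

lemma certificate_zero_right (y q qi : R) (k : ℕ) : certificate y q qi k 0 = 0 := by
  cases k with
  | zero => simp [certificate]
  | succ k => simp [certificate, newton, prod_range_succ']

/-- Summed over `i`, the certificate terms telescope to zero, leaving the recurrence of
`connection_succ_zero`. Dividing out the common factor reduces the claim to the polynomial identity
`core`. -/
lemma mass_mul_newton_succ {q qi : R} (hq : q * qi = 1) (y : R) (k i : ℕ) :
    mass y q qi i * newton y q qi (k + 1) i =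
      y * qNum q (k + 1) * qi ^ k * (mass y q qi i * newton y q qi k i) +
        (certificate y q qi k (i + 1) - certificate y q qi k i) := by
  have hi : qi ^ i * q ^ i = 1 := by rw [← mul_pow, mul_comm, hq, one_pow]
  have hk : qi ^ k * q ^ k = 1 := by rw [← mul_pow, mul_comm, hq, one_pow]
  have hQ : qi ^ ((i + 1) ^ 2 + (i + 1)) * q ^ (2 * (i + 1)) = qi ^ (i ^ 2 + i) := by
    rw [show (i + 1) ^ 2 + (i + 1) = (i ^ 2 + i) + 2 * (i + 1) by ring, pow_add, mul_assoc,
      ← mul_pow, mul_comm qi, hq, one_pow, mul_one]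
  have hG : certificate y q qi k (i + 1) = -(y ^ i * y * qi ^ (i ^ 2 + i) * (q ^ k *
      qNum q (i + 1) * newton y q qi k i * (1 - y * qi ^ i * qi ^ k))) := by
    rw [certificate, mul_assoc (y ^ (i + 1)), hQ, ← newton_succ_right, pow_succ y,
      show y * q * qi ^ (i + 1) = (q * qi) * (y * qi ^ i) by ring, hq]
    ring
  have core : (q ^ (2 * i) - y) * ((qNum q i - qNum q k) * (1 - y * qi ^ i * qi ^ k) -
      y * qNum q (k + 1) * qi ^ k) =
      -(y * (q ^ k * qNum q (i + 1) * (1 - y * qi ^ i * qi ^ k))) +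
        q ^ (2 * i) * (1 - y * q * qi ^ i) * (qNum q i - qNum q k) := by
    have e1 := qNum_succ' q i
    have e2 := qNum_succ' q k
    have e3 := qNum_succ q i
    have e4 := qNum_succ q k
    have e5 := pow_mul_qNum_sub q i k
    rw [mul_comm 2 i, pow_mul]
    generalize q ^ i = a at *
    generalize q ^ k = b at *
    generalize qi ^ i = a' at *
    generalize qi ^ k = b' at *
    generalize qNum q i = I at *
    generalize qNum q k = K at *
    generalize qNum q (i + 1) = I' at *
    generalize qNum q (k + 1) = K' at *
    grind
  rw [hG, certificate, newton_succ, mass]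
  linear_combination (y ^ i * qi ^ (i ^ 2 + i) * newton y q qi k i) * core

/-- A telescoping form of the masses, which makes the total mass `1`. -/
lemma mass_eq_sub {q qi : R} (hq : q * qi = 1) (y : R) (i : ℕ) :
    mass y q qi i =
      -(y ^ (i + 1) * qi ^ ((i + 1) ^ 2 + (i + 1)) * q ^ (2 * (i + 1))) -
        -(y ^ i * qi ^ (i ^ 2 + i) * q ^ (2 * i)) := by
  have hQ : qi ^ ((i + 1) ^ 2 + (i + 1)) * q ^ (2 * (i + 1)) = qi ^ (i ^ 2 + i) := by
    rw [show (i + 1) ^ 2 + (i + 1) = (i ^ 2 + i) + 2 * (i + 1) by ring, pow_add, mul_assoc,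
      ← mul_pow, mul_comm qi, hq, one_pow, mul_one]
  rw [mass, mul_assoc (y ^ (i + 1)), hQ]
  ring

/-! ### Summation in the `y`-adic topology -/

section Summation

open scoped PowerSeries.WithPiTopology

variable [TopologicalSpace R]

lemma hasSum_sub_of_X_pow_dvd {G : ℕ → PowerSeries R} (hG : ∀ i, PowerSeries.X ^ i ∣ G i) :
    HasSum (fun i => G (i + 1) - G i) (-G 0) := by
  rw [PowerSeries.WithPiTopology.hasSum_iff_hasSum_coeff]
  intro d
  have hz : ∀ i, d < i → PowerSeries.coeff d (G i) = 0 := fun i hi =>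
    PowerSeries.X_pow_dvd_iff.1 (hG i) d hi
  have e : PowerSeries.coeff d (-G 0) =
      ∑ i ∈ range (d + 1), PowerSeries.coeff d (G (i + 1) - G i) := by
    rw [← map_sum, sum_range_sub, map_sub, hz _ (Nat.lt_succ_self d), map_neg, zero_sub]
  rw [e]
  refine hasSum_sum_of_ne_finset_zero fun i hi => ?_
  rw [mem_range, not_lt] at hi
  rw [map_sub, hz _ (by omega), hz _ (by omega), sub_zero]

lemma hasSum_mass_mul_newton [IsTopologicalRing R] {q qi : PowerSeries R} (hq : q * qi = 1)
    (r k : ℕ) :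
    HasSum (fun i => mass PowerSeries.X q qi i * node PowerSeries.X q qi i ^ r *
      newton PowerSeries.X q qi k i) (newtonMoment PowerSeries.X q qi r k) := by
  induction r generalizing k with
  | zero =>
    simp only [pow_zero, mul_one, newtonMoment_zero_left]
    induction k with
    | zero =>
      simp only [newton, range_zero, prod_empty, mul_one, mass_eq_sub hq, connection]
      convert hasSum_sub_of_X_pow_dvd (R := R)
        (G := fun i => -(PowerSeries.X ^ i * qi ^ (i ^ 2 + i) * q ^ (2 * i))) (fun i => ?_) using 1
      · simp
      · rw [mul_assoc]
        exact (dvd_mul_right _ _).neg_right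
    | succ k ih =>
      simp only [mass_mul_newton_succ hq, connection_succ_zero hq]
      have h := hasSum_sub_of_X_pow_dvd (G := certificate (PowerSeries.X : PowerSeries R) q qi k)
        fun i => by
          simp only [certificate, mul_assoc]
          exact (dvd_mul_right _ _).neg_right
      rw [certificate_zero_right, neg_zero] at h
      simpa using (ih.mul_left (PowerSeries.X * qNum q (k + 1) * qi ^ k)).add h
  | succ r ih =>
    -- Both sides obey the same recursion in `r`: at node `i`, `x N_k = N_{k+1} + node k * N_k` is
    -- `node_sub_mul_newton`.
    rw [newtonMoment_succ_left hq]
    convert (ih (k + 1)).add ((ih k).mul_left (node PowerSeries.X q qi k)) using 2 with i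
    rw [node_sub_mul_newton hq]
    ring

/-- The moments of the discrete measure. -/
theorem hasSum_mass_mul_node_pow [IsTopologicalRing R] {q qi : PowerSeries R} (hq : q * qi = 1)
    (n : ℕ) :
    HasSum (fun i => mass PowerSeries.X q qi i * node PowerSeries.X q qi i ^ n)
      (mu n PowerSeries.X q) := by
  simpa [newton, newtonMoment_zero_right] using hasSum_mass_mul_newton hq n 0

end Summation

/-! ### Extraction of coefficients in `y` -/

lemma X_pow_dvd_mass (q qi : PowerSeries R) (i : ℕ) :
    PowerSeries.X ^ i ∣ mass PowerSeries.X q qi i := by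
  rw [mass, mul_assoc]
  exact dvd_mul_right _ _

lemma coeff_mu_eq_sum {q qi : PowerSeries R} (hq : q * qi = 1) (n k : ℕ) :
    PowerSeries.coeff k (mu n PowerSeries.X q) =
      ∑ i ∈ range (k + 1), PowerSeries.coeff k
        (mass PowerSeries.X q qi i * node PowerSeries.X q qi i ^ n) := by
  let _ : TopologicalSpace R := ⊥
  have _ : DiscreteTopology R := ⟨rfl⟩
  refine ((PowerSeries.WithPiTopology.hasSum_iff_hasSum_coeff R).1
    (hasSum_mass_mul_node_pow hq n) k).unique (hasSum_sum_of_ne_finset_zero fun i hi => ?_)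
  rw [mem_range, not_lt] at hi
  exact PowerSeries.X_pow_dvd_iff.1 ((X_pow_dvd_mass q qi i).mul_right _) k (by omega)

lemma map_qNum {S : Type*} [CommRing S] (f : R →+* S) (q : R) (i : ℕ) :
    f (qNum q i) = qNum (f q) i := by
  simp [qNum]

lemma coeff_one_sub_X_mul_C_pow (a : R) (n j : ℕ) :
    PowerSeries.coeff j ((1 - PowerSeries.X * PowerSeries.C a) ^ n) =
      (-a) ^ j * (n.choose j : R) := by
  have : (1 - PowerSeries.X * PowerSeries.C a) ^ n =
      PowerSeries.rescale (-a) (((1 + Polynomial.X : Polynomial R) ^ n : Polynomial R) :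
        PowerSeries R) := by
    simp [PowerSeries.rescale_X, sub_eq_add_neg, mul_comm]
  rw [this, PowerSeries.coeff_rescale, Polynomial.coeff_coe, Polynomial.coeff_one_add_X_pow]

lemma coeff_mass_mul_node_pow (q : Rˣ) (n i j : ℕ) :
    PowerSeries.coeff (i + j) (mass PowerSeries.X (PowerSeries.C (q : R))
      (PowerSeries.C ((q⁻¹ : Rˣ) : R)) i * node PowerSeries.X (PowerSeries.C (q : R))
      (PowerSeries.C ((q⁻¹ : Rˣ) : R)) i ^ n) =
    (-1 : R) ^ j * qNum (q : R) i ^ n *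
      ((q ^ (((i + j : ℕ) : ℤ) * ((j : ℤ) - ((i + j : ℕ) : ℤ))) : Rˣ) : R) *
      ((chooseInt n (j : ℤ) : R) * (q : R) ^ i + (chooseInt n ((j : ℤ) - 1) : R)) := by
  set p : R := ((q⁻¹ : Rˣ) : R) with hp
  have hqp : (q : R) * p = 1 := q.mul_inv
  have hz : ((q ^ (((i + j : ℕ) : ℤ) * ((j : ℤ) - ((i + j : ℕ) : ℤ))) : Rˣ) : R) =
      p ^ ((i + j) * i) := by
    rw [show ((i + j : ℕ) : ℤ) * ((j : ℤ) - ((i + j : ℕ) : ℤ)) = -(((i + j) * i : ℕ) : ℤ) by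
      push_cast; ring, zpow_neg, zpow_natCast, ← inv_pow, Units.val_pow_eq_pow_val]
  have h1 : mass PowerSeries.X (PowerSeries.C (q : R)) (PowerSeries.C p) i *
      node PowerSeries.X (PowerSeries.C (q : R)) (PowerSeries.C p) i ^ n =
      PowerSeries.X ^ i * (PowerSeries.C (p ^ (i ^ 2 + i) * qNum (q : R) i ^ n) *
        ((PowerSeries.C ((q : R) ^ (2 * i)) - PowerSeries.X) *
          (1 - PowerSeries.X * PowerSeries.C (p ^ i)) ^ n)) := by
    simp only [mass, node, map_mul, map_pow, map_qNum, mul_pow]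
    ring
  have h2 : p ^ (i ^ 2 + i) * (q : R) ^ (2 * i) * p ^ (i * j) = p ^ ((i + j) * i) * (q : R) ^ i := by
    have e : (q : R) ^ i * p ^ i = 1 := by rw [← mul_pow, hqp, one_pow]
    -- One factor `q ^ i` of `q ^ (2 * i)` cancels the `i` in the exponent `i ^ 2 + i`; the other
    -- survives beside `n.choose j`.
    rw [two_mul, add_mul, pow_add, pow_add, pow_add, sq]
    linear_combination (p ^ (i * i) * (q : R) ^ i * p ^ (i * j)) * e
  rw [hz, h1, add_comm i j, PowerSeries.coeff_X_pow_mul, PowerSeries.coeff_C_mul, sub_mul, map_sub,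
    PowerSeries.coeff_C_mul, coeff_one_sub_X_mul_C_pow, neg_pow (p ^ i), ← pow_mul]
  cases j with
  | zero =>
    simp only [chooseInt, PowerSeries.coeff_zero_X_mul]
    simp at h2 ⊢
    linear_combination qNum (q : R) i ^ n * h2
  | succ j =>
    rw [PowerSeries.coeff_succ_X_mul, coeff_one_sub_X_mul_C_pow, neg_pow (p ^ i), ← pow_mul]
    have c1 : chooseInt n ((j + 1 : ℕ) : ℤ) = n.choose (j + 1) := by
      rw [chooseInt, if_neg (by omega), Int.toNat_natCast]
    have c2 : chooseInt n (((j + 1 : ℕ) : ℤ) - 1) = n.choose j := by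
      rw [chooseInt, if_neg (by omega)]
      congr 1
      omega
    have h3 : p ^ (i ^ 2 + i) * p ^ (i * j) = p ^ ((i + (j + 1)) * i) := by ring
    rw [c1, c2, add_comm (j + 1) i]
    linear_combination (-1) ^ (j + 1) * qNum (q : R) i ^ n *
      ((n.choose (j + 1) : R) * h2 + (n.choose j : R) * h3)

lemma coeff_mu (q : Rˣ) {n : ℕ} (hn : 1 ≤ n) (k : ℕ) :
    PowerSeries.coeff k (mu n PowerSeries.X (PowerSeries.C (q : R))) =
      ∑ i ∈ range k,
        (-1 : R) ^ i * qNum (q : R) (k - i) ^ n *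
          ((q ^ ((k : ℤ) * ((i : ℤ) - (k : ℤ))) : Rˣ) : R) *
          ((chooseInt n (i : ℤ) : R) * (q : R) ^ (k - i) + (chooseInt n ((i : ℤ) - 1) : R)) := by
  have hq : PowerSeries.C (q : R) * PowerSeries.C ((q⁻¹ : Rˣ) : R) = 1 := by
    rw [← map_mul, q.mul_inv, map_one]
  rw [coeff_mu_eq_sum hq, ← sum_range_reflect, sum_range_succ]
  have h0 : k + 1 - 1 - k = 0 := by omega
  -- After reflection, the last term belongs to the node `0`; its `n`-th power vanishes since `n ≥
  -- 1`.
  rw [h0, node, qNum_zero, zero_mul, zero_pow (by omega), mul_zero, map_zero, add_zero]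
  refine sum_congr rfl fun i hi => ?_
  have hik : k - i + i = k := Nat.sub_add_cancel (mem_range.1 hi).le
  have h := coeff_mass_mul_node_pow q n (k - i) i
  rw [hik] at h
  exact h

lemma wex_le {n : ℕ} (σ : Equiv.Perm (Fin n)) : wex σ ≤ n :=
  (card_le_univ _).trans_eq (Fintype.card_fin n)

/-- As a polynomial in `y` of degree at most `n`, `mu` can be evaluated at any ring element from its
power series coefficients. -/
lemma mu_eq_sum_coeff (n : ℕ) (y q : R) :
    mu n y q = ∑ k ∈ range (n + 1),
      y ^ k * PowerSeries.coeff k (mu n PowerSeries.X (PowerSeries.C q)) := by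
  simp only [mu, map_sum, mul_sum]
  rw [sum_comm]
  refine sum_congr rfl fun σ _ => ?_
  simp only [← map_pow, PowerSeries.coeff_mul_C, PowerSeries.coeff_X_pow]
  rw [sum_eq_single_of_mem (wex σ) (mem_range.2 (Nat.lt_succ_of_le (wex_le σ)))]
  · simp
  · intro k _ hk
    simp [hk]

/-! ### The generating function -/

open SeriesYT in
lemma momentSummand_eq_mk (q : Rˣ) (i : ℕ) :
    momentSummand (q : R) i = PowerSeries.mk fun n =>
      mass PowerSeries.X (PowerSeries.C (q : R)) (PowerSeries.C ((q⁻¹ : Rˣ) : R)) i *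
        node PowerSeries.X (PowerSeries.C (q : R)) (PowerSeries.C ((q⁻¹ : Rˣ) : R)) i ^ n := by
  set q' : PowerSeries R := PowerSeries.C (q : R) with hq'
  set p : PowerSeries R := PowerSeries.C ((q⁻¹ : Rˣ) : R) with hp
  have hq : q' * p = 1 := by rw [hq', hp, ← map_mul, q.mul_inv, map_one]
  have hqi : q' ^ i * p ^ i = 1 := by rw [← mul_pow, hq, one_pow]
  have hqi2 : q' ^ (i ^ 2) * p ^ (i ^ 2) = 1 := by rw [← mul_pow, hq, one_pow]
  set x := node PowerSeries.X q' p i with hx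
  have hdenom : denom (q : R) i = PowerSeries.C (q' ^ (i ^ 2) * q' ^ i) *
      (1 - PowerSeries.C x * PowerSeries.X) := by
    have e : q' ^ i * x = qNum q' i * q' ^ i - qNum q' i * PowerSeries.X := by
      rw [hx, node]
      linear_combination (-(qNum q' i * PowerSeries.X)) * hqi
    have e' := congrArg (PowerSeries.C (R := PowerSeries R)) e
    simp only [map_mul, map_sub, map_pow, map_qNum] at e'
    simp only [denom, const, t, y, ← hq', map_mul, map_pow]
    linear_combination (PowerSeries.C q' ^ (i ^ 2) * PowerSeries.X) * e'
  -- The geometric series of ratio `x t`, cleared of its denominator.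
  have hgeom : (PowerSeries.mk fun n => mass PowerSeries.X q' p i * x ^ n) *
      (1 - PowerSeries.C x * PowerSeries.X) = PowerSeries.C (mass PowerSeries.X q' p i) := by
    ext1 n
    rw [mul_sub, mul_one, map_sub, mul_left_comm, PowerSeries.coeff_C_mul]
    cases n with
    | zero => simp
    | succ n => simp [PowerSeries.coeff_succ_mul_X, pow_succ]; ring
  have hnum : (PowerSeries.mk fun n => mass PowerSeries.X q' p i * x ^ n) * denom (q : R) i =
      y ^ i * (const (q : R) ^ (2 * i) - y) := by
    rw [hdenom, mul_left_comm, hgeom, ← map_mul]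
    simp only [y, const, ← hq', ← map_pow, ← map_sub, ← map_mul]
    congr 1
    rw [mass, pow_add p]
    linear_combination (PowerSeries.X ^ i * (q' ^ (2 * i) - PowerSeries.X)) * (hqi2 * q' ^ i * p ^ i
      + hqi)
  rw [momentSummand, ← hnum, mul_assoc, Ring.mul_inverse_cancel _ (isUnit_denom q i), mul_one]

open scoped PowerSeries.WithPiTopology in
lemma hasFormalSum_momentSummand (q : Rˣ) :
    SeriesYT.HasFormalSum (fun i : ℕ => momentSummand (q : R) i) (momentSeries (q : R)) := by
  have hq : PowerSeries.C (q : R) * PowerSeries.C ((q⁻¹ : Rˣ) : R) = 1 := by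
    rw [← map_mul, q.mul_inv, map_one]
  let _ : TopologicalSpace R := ⊥
  have _ : DiscreteTopology R := ⟨rfl⟩
  refine (PowerSeries.WithPiTopology.hasSum_iff_hasSum_coeff _).2 fun n => ?_
  simp only [momentSummand_eq_mk, momentSeries, PowerSeries.coeff_mk]
  exact hasSum_mass_mul_node_pow hq n

end QLaguerre

theorem mainTheorem6 {R : Type*} [CommRing R] (q : Rˣ) :
    (∀ n : ℕ, 1 ≤ n → ∀ y : R,
      QLaguerre.mu n y (q : R) =
        ∑ k ∈ Finset.Icc 1 n, y ^ k *
          ∑ i ∈ Finset.range k,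
            (-1 : R) ^ i * QLaguerre.qNum (q : R) (k - i) ^ n *
              ((q ^ ((k : ℤ) * ((i : ℤ) - (k : ℤ))) : Rˣ) : R) *
              ((QLaguerre.chooseInt n (i : ℤ) : R) * (q : R) ^ (k - i) +
                (QLaguerre.chooseInt n ((i : ℤ) - 1) : R))) ∧
    QLaguerre.SeriesYT.HasFormalSum
      (fun i : ℕ => QLaguerre.momentSummand (q : R) i)
      (QLaguerre.momentSeries (q : R)) := by
  constructor
  · intro n hn y
    rw [QLaguerre.mu_eq_sum_coeff]
    simp only [QLaguerre.coeff_mu q hn]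
    symm
    refine Finset.sum_subset (fun k hk => ?_) fun k hk hk' => ?_
    · rw [Finset.mem_Icc] at hk
      exact Finset.mem_range.2 (by omega)
    · rw [Finset.mem_range] at hk
      rw [Finset.mem_Icc] at hk'
      obtain rfl : k = 0 := by omega
      simp
  · exact QLaguerre.hasFormalSum_momentSummand q
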